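/- Let $\mathbb F=\mathbb F_2$ and let $n\ge 0$. Let $G_n$ be the quiver with vertices $0,1,\dots,n$ and, for each $0\le i<n$, exactly two arrows ${}_ix_{i+1}$ and ${}_i\iota_{i+1}$ from $i$ to $i+1$. Let $A_n$ be the quotient of the path algebra $\mathbb F G_n$, in which a product $pq$ of paths is the path "first $q$, then $p$" if $q$ ends where $p$ starts and is $0$ otherwise, by the two-sided ideal generated by the relations $${}_{i+1}\iota_{i+2}\;{}_{i}x_{i+1}={}_{i+1}x_{i+2}\;{}_{i}\iota_{i+1},\qquad {}_{i+1}x_{i+2}\;{}_{i}x_{i+1}=0\qquad(0\le i\le n-2).$$ For an $\mathbb F$-algebra $A$ (placed in degree $0$), a complex of $A$-$A$-bimodules is a finite cell bimodule if it has a finite filtration by subcomplexes $0=F_0\subset F_1\subset\dots\subset F_r$ (with $F_r$ the whole complex) such that each quotient $F_j/F_{j-1}$ is isomorphic to a shift of the free bimodule $A\otimes_{\mathbb F}A$. A finite cell retract is a retract, in the category of complexes of bimodules, of a finite cell bimodule. The algebra $A$ is homologically smooth if there is a quasi-isomorphism of complexes of $A$-$A$-bimodules from a finite cell retract to $A$.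 **Proposition.** For every $n\ge 0$ the algebra $A_n$ is homologically smooth. -/

import Mathlib

open scoped TensorProduct
open CategoryTheory

noncomputable section

/-! ### Path algebras -/

/-- A path in the quiver `V`, together with its source `p.1` and its target `p.2.1`. -/
abbrev QPath (V : Type*) [Quiver V] := Σ a b : V, Quiver.Path a b

/-- The path algebra of the quiver `V` over `k`: the free `k`-module on all paths of `V`,
including the paths of length `0` (one for each vertex). -/
def PathAlgebra (k : Type*) [CommRing k] (V : Type*) [Quiver V] := QPath V →₀ k

namespace PathAlgebra

section

variable (k : Type*) [CommRing k] {V : Type*} [Quiver V]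

instance : AddCommGroup (PathAlgebra k V) := inferInstanceAs (AddCommGroup (QPath V →₀ k))

instance : Module k (PathAlgebra k V) := inferInstanceAs (Module k (QPath V →₀ k))

/-- The basis element of the path algebra given by a path. -/
def of (p : QPath V) : PathAlgebra k V := Finsupp.single p (1 : k)

/-- The idempotent of the path algebra given by a vertex. -/
def vertex (v : V) : PathAlgebra k V := of k ⟨v, v, Quiver.Path.nil⟩

/-- The element of the path algebra given by an arrow. -/
def arrow {a b : V} (e : a ⟶ b) : PathAlgebra k V := of k ⟨a, b, e.toPath⟩

theorem induction_on {P : PathAlgebra k V → Prop} (f : PathAlgebra k V) (zero : P 0)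
    (add : ∀ f g, P f → P g → P (f + g)) (smul_of : ∀ (c : k) p, P (c • of k p)) : P f := by
  refine Finsupp.induction_linear (motive := P) f zero add fun p c => ?_
  have h : c • of k p = Finsupp.single p c := by
    change c • Finsupp.single p (1 : k) = _
    simp
  exact h ▸ smul_of c p

end

section

variable (k : Type*) [CommRing k] {V : Type*} [Quiver V] [DecidableEq V]

/-- The product of two paths: the path "first `q`, then `p`" if `q` ends where `p` starts, and
`0` otherwise. -/
def mulPath (p q : QPath V) : PathAlgebra k V :=
  if h : q.2.1 = p.1 then of k ⟨q.1, p.2.1, (q.2.2.cast rfl h).comp p.2.2⟩ else 0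

/-- The bilinear extension of the product of paths. -/
def mulLin : PathAlgebra k V →ₗ[k] PathAlgebra k V →ₗ[k] PathAlgebra k V :=
  Finsupp.lift (PathAlgebra k V →ₗ[k] PathAlgebra k V) k (QPath V)
    fun p => Finsupp.lift (PathAlgebra k V) k (QPath V) fun q => mulPath k p q

theorem mulLin_of_of (p q : QPath V) : mulLin k (of k p) (of k q) = mulPath k p q := by
  have lift_single : ∀ {M : Type _} [AddCommGroup M] [Module k M] (φ : QPath V → M) (p : QPath V),
      Finsupp.lift M k (QPath V) φ (Finsupp.single p 1) = φ p := by
    intro M _ _ φ p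
    simp
  have h1 : mulLin k (of k p) = Finsupp.lift (PathAlgebra k V) k (QPath V)
      fun q => mulPath k p q :=
    lift_single (M := PathAlgebra k V →ₗ[k] PathAlgebra k V) _ p
  rw [h1]
  exact lift_single (M := PathAlgebra k V) _ q

theorem mulLin_assoc_of (p q r : QPath V) :
    mulLin k (mulLin k (of k p) (of k q)) (of k r) =
      mulLin k (of k p) (mulLin k (of k q) (of k r)) := by
  obtain ⟨a, b, p⟩ := p
  obtain ⟨c, d, q⟩ := q
  obtain ⟨e, f, r⟩ := r
  by_cases h : d = a
  · subst h
    by_cases h' : f = c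
    · subst h'
      simp [mulLin_of_of, mulPath]
    · simp [mulLin_of_of, mulPath, h']
  · by_cases h' : f = c
    · subst h'
      simp [mulLin_of_of, mulPath, h]
    · simp [mulLin_of_of, mulPath, h, h']

theorem mulLin_assoc (f g h : PathAlgebra k V) :
    mulLin k (mulLin k f g) h = mulLin k f (mulLin k g h) := by
  induction f using induction_on with
  | zero => simp
  | add f f' hf hf' => simp [hf, hf']
  | smul_of c p =>
    induction g using induction_on with
    | zero => simp
    | add g g' hg hg' => simp only [map_add, LinearMap.add_apply, hg, hg']
    | smul_of d q =>
      induction h using induction_on with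
      | zero => simp
      | add h h' hh hh' => simp only [map_add, hh, hh']
      | smul_of e r => simp [mulLin_assoc_of]

variable [Fintype V]

/-- The unit of the path algebra: the sum of the idempotents of all vertices. -/
def unit : PathAlgebra k V := ∑ v : V, vertex k v

theorem unit_mulLin (f : PathAlgebra k V) : mulLin k (unit k) f = f := by
  induction f using induction_on with
  | zero => simp
  | add f f' hf hf' => simp [hf, hf']
  | smul_of c p =>
    obtain ⟨a, b, p⟩ := p
    rw [map_smul, unit, map_sum, LinearMap.sum_apply, Finset.sum_eq_single b]
    · simp [vertex, mulLin_of_of, mulPath]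
    · intro v _ hv
      simp [vertex, mulLin_of_of, mulPath, hv.symm]
    · simp

theorem mulLin_unit (f : PathAlgebra k V) : mulLin k f (unit k) = f := by
  induction f using induction_on with
  | zero => simp
  | add f f' hf hf' => simp [hf, hf']
  | smul_of c p =>
    obtain ⟨a, b, p⟩ := p
    rw [map_smul, LinearMap.smul_apply, unit, map_sum, Finset.sum_eq_single a]
    · simp [vertex, mulLin_of_of, mulPath]
    · intro v _ hv
      simp [vertex, mulLin_of_of, mulPath, hv]
    · simp

instance : Ring (PathAlgebra k V) :=
  { (inferInstance : AddCommGroup (PathAlgebra k V)) with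
    mul := fun f g => mulLin k f g
    one := unit k
    mul_assoc := mulLin_assoc k
    one_mul := unit_mulLin k
    mul_one := mulLin_unit k
    zero_mul := fun f => by
      change mulLin k 0 f = 0
      simp
    mul_zero := fun f => by
      change mulLin k f 0 = 0
      simp
    left_distrib := fun f g h => by
      change mulLin k f (g + h) = mulLin k f g + mulLin k f h
      simp
    right_distrib := fun f g h => by
      change mulLin k (f + g) h = mulLin k f h + mulLin k g h
      simp }

instance : Algebra k (PathAlgebra k V) :=
  Algebra.ofModule
    (fun c f g => by
      change mulLin k (c • f) g = c • mulLin k f g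
      simp)
    (fun c f g => by
      change mulLin k f (c • g) = c • mulLin k f g
      simp)

theorem of_mul_of (p q : QPath V) : of k p * of k q = mulPath k p q := mulLin_of_of k p q

end

end PathAlgebra

/-! ### The algebras `A n` -/

/-- The vertices `0, 1, …, n` of the doubled linear quiver. -/
def LinVertex (n : ℕ) := Fin (n + 1)

instance (n : ℕ) : DecidableEq (LinVertex n) := inferInstanceAs (DecidableEq (Fin (n + 1)))

instance (n : ℕ) : Fintype (LinVertex n) := inferInstanceAs (Fintype (Fin (n + 1)))

/-- The two kinds of arrows of the doubled linear quiver. -/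
inductive ArrowKind
  | x
  | iota

/-- The arrows of the doubled linear quiver: for each `i < n` there are precisely two arrows from
`i` to `i + 1`, one of each kind, and there are no others. -/
structure LinArrow {n : ℕ} (a b : LinVertex n) where
  kind : ArrowKind
  step : Fin.val a + 1 = Fin.val b

/-- The quiver with vertices `0, …, n` and two arrows `i ⟶ i + 1` for each `i < n`. -/
instance (n : ℕ) : Quiver (LinVertex n) := ⟨fun a b => LinArrow a b⟩

/-- The arrow of kind `x` from `i` to `i + 1`, as an element of the path algebra. -/
def xElt (k : Type*) [CommRing k] {n : ℕ} (i : Fin n) : PathAlgebra k (LinVertex n) :=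
  PathAlgebra.arrow k (a := i.castSucc) (b := i.succ) ⟨ArrowKind.x, by simp⟩

/-- The arrow of kind `ι` from `i` to `i + 1`, as an element of the path algebra. -/
def iotaElt (k : Type*) [CommRing k] {n : ℕ} (i : Fin n) : PathAlgebra k (LinVertex n) :=
  PathAlgebra.arrow k (a := i.castSucc) (b := i.succ) ⟨ArrowKind.iota, by simp⟩

/-- The relations of `A n`, for consecutive arrows `i ⟶ i + 1 = j ⟶ j + 1`. -/
inductive ARel (k : Type*) [CommRing k] (n : ℕ) :
    PathAlgebra k (LinVertex n) → PathAlgebra k (LinVertex n) → Prop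
  | comm (i j : Fin n) (h : (i : ℕ) + 1 = j) :
      ARel k n (iotaElt k j * xElt k i) (xElt k j * iotaElt k i)
  | sq (i j : Fin n) (h : (i : ℕ) + 1 = j) :
      ARel k n (xElt k j * xElt k i) 0

/-- The algebra `A n` over `k`: the quotient of the path algebra of the doubled linear quiver with
vertices `0, …, n` by the two-sided ideal generated by the relations `ARel`. -/
abbrev AlgA (k : Type*) [CommRing k] (n : ℕ) := RingQuot (ARel k n)

/-! ### Homological smoothness -/

section

universe u

/-- Finite cell (dg) modules over a ring `R` concentrated in degree `0`: the cochain complexes of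
`R`-modules obtained from `0` by finitely many times attaching a cell, that is, passing from a
complex `S.X₁` to a complex `S.X₂` that contains it with quotient isomorphic to a shift of the
free module `R`. -/
inductive IsFiniteCell (R : Type u) [Ring R] : CochainComplex (ModuleCat.{u} R) ℤ → Prop
  | zero (M : CochainComplex (ModuleCat.{u} R) ℤ) (hM : Limits.IsZero M) : IsFiniteCell R M
  | attach (S : ShortComplex (CochainComplex (ModuleCat.{u} R) ℤ)) (hS : S.ShortExact) (d : ℤ)
      (e : S.X₃ ≅ (HomologicalComplex.single (ModuleCat.{u} R) (ComplexShape.up ℤ) d).obj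
        (ModuleCat.of R R))
      (h₁ : IsFiniteCell R S.X₁) : IsFiniteCell R S.X₂

/-- A finite cell retract is a retract (direct summand), in the category of complexes, of a finite
cell module. -/
def IsFiniteCellRetract (R : Type u) [Ring R] (P : CochainComplex (ModuleCat.{u} R) ℤ) : Prop :=
  ∃ C : CochainComplex (ModuleCat.{u} R) ℤ, IsFiniteCell R C ∧ Nonempty (Retract P C)

/-- The `k`-algebra `A` as an `A`-`A`-bimodule, that is, as a left module over the enveloping
algebra `A ⊗[k] Aᵐᵒᵖ`, which acts by `(a ⊗ b) • m = a * m * b`. -/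
def diagonalBimodule (k A : Type u) [CommRing k] [Ring A] [Algebra k A] :
    ModuleCat.{u} (A ⊗[k] Aᵐᵒᵖ) :=
  letI : Module (A ⊗[k] Aᵐᵒᵖ) A := instModuleTensorProductMop k A
  ModuleCat.of (A ⊗[k] Aᵐᵒᵖ) A

/-- A `k`-algebra `A` (in degree `0`) is homologically smooth if the bimodule `A` has a resolution
by a finite cell retract, that is, if there is a quasi-isomorphism of complexes of
`A`-`A`-bimodules from a finite cell retract to `A`. The cells are shifts of the free bimodule
`A ⊗[k] A`, which is the enveloping algebra as a module over itself. -/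
def HomologicallySmooth (k A : Type u) [CommRing k] [Ring A] [Algebra k A] : Prop :=
  ∃ P : CochainComplex (ModuleCat.{u} (A ⊗[k] Aᵐᵒᵖ)) ℤ, IsFiniteCellRetract (A ⊗[k] Aᵐᵒᵖ) P ∧
    ∃ f : P ⟶ (HomologicalComplex.single _ (ComplexShape.up ℤ) 0).obj (diagonalBimodule k A),
      QuasiIso f

end

end

-- Every arrow of the quiver raises the vertex number, so the vertex idempotents make any quotient
-- of its path algebra triangular: $e_w A e_v = 0$ for $w < v$, and $e_v A e_v$ is spanned by $e_v$.
-- The enveloping algebra inherits this structure from $A$ (`IsTriangularFamily.tmul_op`). Over a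
-- triangular ring every module has finite projective dimension: approximating by copies of $R e_v$
-- removes one idempotent at a time from the support (`exists_hasProjectiveDimensionLT`). As $A$ is
-- finite-dimensional, its enveloping algebra is Noetherian, and the diagonal bimodule is generated
-- by $1$. Finitely generated syzygies and iterated mapping cones then turn finite projective
-- dimension into a finite cell retract (`of_hasProjectiveDimensionLE`).

universe u

open Limits ZeroObject

/-! ### Closure properties of finite cell complexes -/

namespace IsFiniteCell

variable {R : Type u} [Ring R]

theorem of_iso {X Y : CochainComplex (ModuleCat.{u} R) ℤ} (hX : IsFiniteCell R X) (e : X ≅ Y) :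
    IsFiniteCell R Y := by
  cases hX with
  | zero _ hM => exact .zero _ (hM.of_iso e.symm)
  | attach S hS d e' h₁ =>
    let T : ShortComplex (CochainComplex (ModuleCat.{u} R) ℤ) :=
      ShortComplex.mk (S.f ≫ e.hom) (e.inv ≫ S.g) (by simp)
    have i : S ≅ T := ShortComplex.isoMk (Iso.refl _) e (Iso.refl _) (by simp [T]) (by simp [T])
    exact .attach T (ShortComplex.shortExact_of_iso i hS) d e' h₁

theorem shift {X : CochainComplex (ModuleCat.{u} R) ℤ} (hX : IsFiniteCell R X) (a : ℤ) :
    IsFiniteCell R (X⟦a⟧) := by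
  induction hX with
  | zero M hM => exact .zero _ ((shiftFunctor _ a).map_isZero hM)
  | attach S hS d e h₁ ih =>
    exact .attach (S.map (shiftFunctor _ a)) (hS.map_of_exact _) (d - a)
      ((shiftFunctor _ a).mapIso e ≪≫
        ((CochainComplex.singleFunctors (ModuleCat.{u} R)).shiftIso a (d - a) d
          (by lia)).app _) ih

/-- Induction on the cells of the quotient: the preimage in `X₂` of the complex below the top cell
is a smaller extension, and `X₂` arises from it by attaching that cell. -/
theorem extension {X₁ X₂ X₃ : CochainComplex (ModuleCat.{u} R) ℤ} (h₁ : IsFiniteCell R X₁)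
    (h₃ : IsFiniteCell R X₃) {f : X₁ ⟶ X₂} {g : X₂ ⟶ X₃} {w : f ≫ g = 0}
    (hS : (ShortComplex.mk f g w).ShortExact) : IsFiniteCell R X₂ := by
  induction h₃ generalizing X₂ with
  | zero M hM =>
    have : IsIso f := hS.isIso_f_iff.2 hM
    exact h₁.of_iso (asIso f)
  | attach T hT d e h ih =>
    have : Epi g := hS.epi_g
    have : Mono f := hS.mono_f
    have := hT.epi_g
    have := hT.mono_f
    let p : X₂ ⟶ T.X₃ := g ≫ T.g
    have : Epi p := epi_comp _ _
    -- `kernel p` is the preimage of `T.X₁` under `g`; the maps `a` and `b` exhibit it as an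
    -- extension of `T.X₁` by `X₁`.
    let a : X₁ ⟶ kernel p := kernel.lift p f (by simp [p, reassoc_of% w])
    let b : kernel p ⟶ T.X₁ := hT.exact.lift (kernel.ι p ≫ g) (by
      rw [Category.assoc]; exact kernel.condition p)
    have hb : b ≫ T.f = kernel.ι p ≫ g := hT.exact.lift_f _ _
    have ha : a ≫ kernel.ι p = f := kernel.lift_ι _ _ _
    have hab : a ≫ b = 0 := by
      rw [← cancel_mono T.f]
      simp [hb, reassoc_of% ha, w]
    have : Mono a := mono_of_mono_fac ha
    have : Epi b := by
      rw [epi_iff_surjective_up_to_refinements]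
      intro A y
      obtain ⟨A', π, hπ, x, hx⟩ := surjective_up_to_refinements_of_epi g (y ≫ T.f)
      refine ⟨A', π, hπ, kernel.lift p x ?_, ?_⟩
      · simp [p, ← reassoc_of% hx]
      · rw [← cancel_mono T.f]
        simp [hb, hx]
    have hex : (ShortComplex.mk a b hab).Exact := by
      rw [ShortComplex.exact_iff_exact_up_to_refinements]
      intro A y hy
      dsimp at y hy
      obtain ⟨A', π, hπ, x, hx⟩ := hS.exact.exact_up_to_refinements (y ≫ kernel.ι p) (by
        simp [← hb, reassoc_of% hy])
      refine ⟨A', π, hπ, x, ?_⟩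
      rw [← cancel_mono (kernel.ι p)]
      simpa [ha] using hx
    have hK := ih (f := a) (g := b) (w := hab) ⟨hex⟩
    exact .attach (ShortComplex.mk (kernel.ι p) p (kernel.condition p))
      ⟨ShortComplex.exact_of_f_is_kernel _ (kernelIsKernel p)⟩ d e hK

theorem mappingCone {X Y : CochainComplex (ModuleCat.{u} R) ℤ} (φ : X ⟶ Y)
    (hX : IsFiniteCell R X) (hY : IsFiniteCell R Y) :
    IsFiniteCell R (CochainComplex.mappingCone φ) :=
  extension hY (hX.shift 1) (HomologicalComplex.shortExact_of_degreewise_shortExact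
    (CochainComplex.mappingCone.triangleRotateShortComplex φ) fun n =>
      (CochainComplex.mappingCone.triangleRotateShortComplexSplitting φ n).shortExact)

theorem single_of_iso {M : ModuleCat.{u} R} (d : ℤ)
    (h : IsFiniteCell R ((HomologicalComplex.single _ (ComplexShape.up ℤ) d).obj M))
    {N : ModuleCat.{u} R} (e : M ≅ N) :
    IsFiniteCell R ((HomologicalComplex.single _ (ComplexShape.up ℤ) d).obj N) :=
  h.of_iso ((HomologicalComplex.single _ (ComplexShape.up ℤ) d).mapIso e)

theorem single_self (d : ℤ) :
    IsFiniteCell R ((HomologicalComplex.single _ (ComplexShape.up ℤ) d).obj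
      (ModuleCat.of R R)) := by
  let X := (HomologicalComplex.single _ (ComplexShape.up ℤ) d).obj (ModuleCat.of R R)
  let S : ShortComplex (CochainComplex (ModuleCat.{u} R) ℤ) :=
    ShortComplex.mk (0 : 0 ⟶ X) (𝟙 X) (by simp)
  have s : S.Splitting := { r := 0, s := 𝟙 _, f_r := (isZero_zero _).eq_of_src _ _ }
  exact .attach S s.shortExact d (Iso.refl _) (.zero _ (isZero_zero _))

theorem single_pi (d : ℤ) (m : ℕ) :
    IsFiniteCell R ((HomologicalComplex.single _ (ComplexShape.up ℤ) d).obj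
      (ModuleCat.of R (Fin m → R))) := by
  induction m with
  | zero =>
    exact .zero _ ((HomologicalComplex.single _ _ d).map_isZero
      (ModuleCat.isZero_of_subsingleton _))
  | succ m ih =>
    refine single_of_iso d (M := ModuleCat.of R (R × (Fin m → R))) ?_
      (Fin.consLinearEquiv R (fun _ => R)).toModuleIso
    let S : ShortComplex (ModuleCat.{u} R) := ShortComplex.mk
      (ModuleCat.ofHom (LinearMap.inl R R (Fin m → R)))
      (ModuleCat.ofHom (LinearMap.snd R R (Fin m → R))) (by ext : 2; rfl)
    have s : S.Splitting :=
      { r := ModuleCat.ofHom (LinearMap.fst R R (Fin m → R))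
        s := ModuleCat.ofHom (LinearMap.inr R R (Fin m → R))
        f_r := by ext; simp [S]
        s_g := by ext; simp [S]
        id := by ext x <;> simp [S] }
    exact extension (single_self d) ih
      (s.map (HomologicalComplex.single _ (ComplexShape.up ℤ) d)).shortExact

end IsFiniteCell

/-! ### Resolutions from finite projective dimension -/

/-- The module `M` has a resolution by a finite cell retract. -/
def HasFiniteCellResolution {R : Type u} [Ring R] (M : ModuleCat.{u} R) : Prop :=
  ∃ P : CochainComplex (ModuleCat.{u} R) ℤ, IsFiniteCellRetract R P ∧
    ∃ f : P ⟶ (HomologicalComplex.single _ (ComplexShape.up ℤ) 0).obj M, QuasiIso f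

namespace HasFiniteCellResolution

variable {R : Type u} [Ring R]

theorem of_projective (M : ModuleCat.{u} R) [Module.Finite R M] [Projective M] :
    HasFiniteCellResolution M := by
  obtain ⟨m, f, hf⟩ := Module.Finite.exists_fin' R M
  have : Epi (ModuleCat.ofHom f) := (ModuleCat.epi_iff_surjective _).2 hf
  let r : Retract M (ModuleCat.of R (Fin m → R)) :=
    { i := Projective.factorThru (𝟙 M) (ModuleCat.ofHom f)
      r := ModuleCat.ofHom f }
  exact ⟨_, ⟨_, IsFiniteCell.single_pi 0 m, ⟨r.map _⟩⟩, 𝟙 _, inferInstance⟩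

/-- In the derived category this is the third map of a morphism of distinguished triangles whose
other two maps are isomorphisms. -/
theorem quasiIso_mappingCone_map {X X' Y : CochainComplex (ModuleCat.{u} R) ℤ} (φ : X ⟶ Y)
    (φ' : X' ⟶ Y) (q : X ⟶ X') (h : φ ≫ 𝟙 Y = q ≫ φ') [QuasiIso q] :
    QuasiIso (CochainComplex.mappingCone.map φ φ' q (𝟙 Y) h) := by
  let _ := HasDerivedCategory.standard (ModuleCat.{u} R)
  rw [← DerivedCategory.isIso_Q_map_iff_quasiIso]
  exact Pretriangulated.isIso₃_of_isIso₁₂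
    (DerivedCategory.Q.mapTriangle.map (CochainComplex.mappingCone.triangleMap φ φ' q (𝟙 Y) h))
    (DerivedCategory.mappingCone_triangle_distinguished φ)
    (DerivedCategory.mappingCone_triangle_distinguished φ')
    
    (inferInstanceAs (IsIso (DerivedCategory.Q.map q)))
    (inferInstanceAs (IsIso (DerivedCategory.Q.map (𝟙 Y))))

/-- The cone of the composite from the resolution of `S.X₁` to `S.X₂` resolves the quotient `S.X₃`.
-/
theorem of_shortExact (S : ShortComplex (ModuleCat.{u} R)) (hS : S.ShortExact)
    (h₁ : HasFiniteCellResolution S.X₁)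
    (h₂ : IsFiniteCell R ((HomologicalComplex.single _ (ComplexShape.up ℤ) 0).obj S.X₂)) :
    HasFiniteCellResolution S.X₃ := by
  obtain ⟨Q, ⟨C, hC, ⟨r⟩⟩, q, hq⟩ := h₁
  let T := S.map (HomologicalComplex.single _ (ComplexShape.up ℤ) 0)
  have hT : T.ShortExact := hS.map_of_exact _
  have hq' : QuasiIso (L := T.X₁) q := hq
  let φ : Q ⟶ T.X₂ := q ≫ T.f
  have hφ : φ ≫ 𝟙 _ = q ≫ T.f := by simp [φ]
  have h₁ : φ ≫ 𝟙 _ = r.i ≫ r.r ≫ φ := by simp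
  have h₂' : (r.r ≫ φ) ≫ 𝟙 _ = r.r ≫ φ := by simp
  -- Precomposing `φ` with the retraction `C ⟶ Q` gives a map between finite cell complexes, whose
  -- cone retracts onto that of `φ`.
  let ρ : Retract (CochainComplex.mappingCone φ) (CochainComplex.mappingCone (r.r ≫ φ)) :=
    { i := CochainComplex.mappingCone.map _ _ r.i (𝟙 _) h₁
      r := CochainComplex.mappingCone.map _ _ r.r (𝟙 _) h₂'
      retract := by
        rw [← CochainComplex.mappingCone.map_comp, ← CochainComplex.mappingCone.map_id]
        congr 1
        all_goals simp }
  have h₃ : QuasiIso (CochainComplex.mappingCone.map φ T.f q (𝟙 _) hφ ≫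
      CochainComplex.mappingCone.descShortComplex T) :=
    have := quasiIso_mappingCone_map φ T.f q hφ
    have := CochainComplex.mappingCone.quasiIso_descShortComplex hT
    quasiIso_comp _ _
  exact ⟨_, ⟨_, hC.mappingCone _ h₂, ⟨ρ⟩⟩, _, h₃⟩

/-- The kernel of a finite free cover has smaller projective dimension, and the Noetherian
hypothesis keeps it finitely generated. The last syzygy is only projective, which is where retracts
are needed. -/
theorem of_hasProjectiveDimensionLE [IsNoetherianRing R] (d : ℕ) (M : ModuleCat.{u} R)
    [Module.Finite R M] (h : HasProjectiveDimensionLE M d) : HasFiniteCellResolution M := by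
  induction d generalizing M with
  | zero =>
    have := (projective_iff_hasProjectiveDimensionLE_zero M).2 h
    exact of_projective M
  | succ d ih =>
    obtain ⟨m, f, hf⟩ := Module.Finite.exists_fin' R M
    let S : ShortComplex (ModuleCat.{u} R) := ShortComplex.mk
      (ModuleCat.ofHom (LinearMap.ker f).subtype) (ModuleCat.ofHom f) (by ext; simp)
    have hS : S.ShortExact :=
      { exact := (ShortComplex.ShortExact.moduleCat_exact_iff_function_exact S).2
          (LinearMap.exact_subtype_ker_map f)
        mono_f := (ModuleCat.mono_iff_injective _).2 (Submodule.subtype_injective _)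
        epi_g := (ModuleCat.epi_iff_surjective _).2 hf }
    have : Projective S.X₂ :=
      (IsProjective.iff_projective (R := R) (P := Fin m → R)).1 inferInstance
    refine of_shortExact S hS (ih _ ?_) (IsFiniteCell.single_pi 0 m)
    exact hS.hasProjectiveDimensionLT_X₁ (d + 1)
      (hasProjectiveDimensionLT_of_ge _ 1 (d + 1) (by lia)) h

end HasFiniteCellResolution

/-! ### Triangular families and finite projective dimension -/

/-- A finite family of idempotents with sum `1`, indexed by a linear order, for which the ring is
lower triangular with one-dimensional diagonal blocks. -/
structure IsTriangularFamily (k : Type*) {R V : Type*} [Field k] [Ring R] [Algebra k R]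
    [LinearOrder V] [Fintype V] (e : V → R) : Prop where
  idem (v : V) : e v * e v = e v
  sum_eq_one : ∑ v, e v = 1
  mul_mul_eq_zero {w v : V} (h : w < v) (r : R) : e w * r * e v = 0
  exists_smul_eq (v : V) (r : R) : ∃ c : k, e v * r * e v = c • e v

namespace ModuleCat

variable {R : Type u} [Ring R] {M N : Type u} [AddCommGroup M] [Module R M] [AddCommGroup N]
  [Module R N]

theorem exists_hasProjectiveDimensionLT_of_ker_of_coker (φ : M →ₗ[R] N) [Module.Projective R M]
    (hK : ∃ d, HasProjectiveDimensionLT (of R (LinearMap.ker φ)) d)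
    (hC : ∃ d, HasProjectiveDimensionLT (of R (N ⧸ LinearMap.range φ)) d) :
    ∃ d, HasProjectiveDimensionLT (of R N) d := by
  obtain ⟨a, ha⟩ := hK
  obtain ⟨b, hb⟩ := hC
  let S : ShortComplex (ModuleCat.{u} R) := ShortComplex.mk
    (ofHom (LinearMap.ker φ).subtype) (ofHom φ.rangeRestrict) (by ext ⟨x, hx⟩; simpa using hx)
  have hS : S.ShortExact :=
    { exact := (ShortComplex.ShortExact.moduleCat_exact_iff_function_exact S).2 <| by
        intro x
        simp [S, Subtype.ext_iff]
      mono_f := (mono_iff_injective _).2 (Submodule.subtype_injective _)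
      epi_g := (epi_iff_surjective _).2 φ.surjective_rangeRestrict }
  let T : ShortComplex (ModuleCat.{u} R) := ShortComplex.mk
    (ofHom (LinearMap.range φ).subtype) (ofHom (LinearMap.range φ).mkQ) (by ext; simp)
  have hT : T.ShortExact :=
    { exact := (ShortComplex.ShortExact.moduleCat_exact_iff_function_exact T).2
        (LinearMap.exact_subtype_mkQ _)
      mono_f := (mono_iff_injective _).2 (Submodule.subtype_injective _)
      epi_g := (epi_iff_surjective _).2 (Submodule.mkQ_surjective _) }
  have : Projective S.X₂ := (IsProjective.iff_projective (R := R) (P := M)).1 inferInstance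
  have h₃ : HasProjectiveDimensionLT S.X₃ (a + 1) :=
    hS.hasProjectiveDimensionLT_X₃ a ha (hasProjectiveDimensionLT_of_ge _ 1 (a + 1) (by lia))
  exact ⟨a + 1 + b, hT.hasProjectiveDimensionLT_X₂ (a + 1 + b)
    (hasProjectiveDimensionLT_of_ge _ (a + 1) _ (by lia))
    (hasProjectiveDimensionLT_of_ge _ b _ (by lia))⟩

end ModuleCat

namespace IsTriangularFamily

variable {k R V : Type*} [Field k] [Ring R] [Algebra k R] [LinearOrder V] [Fintype V] {e : V → R}

theorem projective_span (h : IsTriangularFamily k e) (v : V) :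
    Module.Projective R (Submodule.span R {e v}) := by
  refine .of_split (Submodule.span R {e v}).subtype
    ((LinearMap.toSpanSingleton R R (e v)).codRestrict _ fun r =>
      Submodule.smul_mem _ r (Submodule.mem_span_singleton_self _)) ?_
  ext ⟨x, hx⟩
  obtain ⟨r, rfl⟩ := Submodule.mem_span_singleton.1 hx
  change (r * e v) * e v = r * e v
  rw [mul_assoc, h.idem]

/-- There is a map from a direct sum of copies of `R e_v` to `M` that is bijective on
`e_v`-components. -/
theorem exists_approx {R : Type u} [Ring R] [Algebra k R] {e : V → R}
    (h : IsTriangularFamily k e) (v : V) (M : Type u) [AddCommGroup M]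
    [Module R M] : ∃ (ι : Type u) (φ : (ι →₀ Submodule.span R {e v}) →ₗ[R] M),
      (∀ x, φ x = 0 → e v • x = 0) ∧ ∀ m, e v • m ∈ LinearMap.range φ := by
  let _ : Module k M := Module.compHom M (algebraMap k R)
  have : IsScalarTower k R M := .of_algebraMap_smul fun _ _ => rfl
  have : SMulCommClass R k M := IsScalarTower.to_smulCommClass'
  -- `W` is the component $e_v M$; the map uses one copy of $R e_v$ for each element of a `k`-basis
  -- of it.
  let W : Submodule k M :=
    { carrier := {m | e v • m = m}
      add_mem' := by
        intro a b ha hb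
        simp_all
      zero_mem' := by simp
      smul_mem' := by
        intro c m hm
        simp only [Set.mem_ofPred_eq] at hm ⊢
        rw [smul_comm, hm] }
  let b := Module.Basis.ofVectorSpace k W
  let ψ := fun i => (LinearMap.toSpanSingleton R M (b i : M)).comp
    (Submodule.span R {e v}).subtype
  refine ⟨_, Finsupp.lsum ℕ ψ, fun x hx => ?_, fun m => ?_⟩
  -- Since $e_v R e_v$ is spanned by $e_v$, applying $e_v$ to `φ x = 0` gives a `k`-linear relation
  -- among basis vectors.
  · have key (i) : ∃ c : k, e v • (x i : R) = c • e v := by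
      obtain ⟨r, hr⟩ := Submodule.mem_span_singleton.1 (x i).2
      rw [← hr, smul_eq_mul, smul_eq_mul, ← mul_assoc]
      exact h.exists_smul_eq v r
    choose c hc using key
    have hsum : ∑ i ∈ x.support, c i • b i = 0 := by
      have := congrArg (e v • ·) hx
      simp only [Finsupp.lsum_apply, Finsupp.sum, smul_zero, Finset.smul_sum] at this
      apply Subtype.ext
      rw [AddSubmonoidClass.coe_finsetSum, Submodule.coe_zero, ← this]
      refine Finset.sum_congr rfl fun i _ => ?_
      have hb : e v • (b i : M) = b i := (b i).2
      simp only [ψ, LinearMap.comp_apply, LinearMap.toSpanSingleton_apply, Submodule.subtype_apply]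
      rw [← mul_smul, ← smul_eq_mul, hc, smul_assoc, hb, Submodule.coe_smul]
    have hc0 := linearIndependent_iff'.1 b.linearIndependent x.support c hsum
    ext i
    rw [Finsupp.smul_apply, Submodule.coe_smul, hc]
    by_cases hi : i ∈ x.support
    · simp [hc0 i hi]
    · rw [← hc, Finsupp.notMem_support_iff.1 hi]
      simp
  · have hm : e v • m ∈ W := by
      change e v • e v • m = e v • m
      rw [← mul_smul, h.idem]
    have hrepr := congrArg Subtype.val (b.linearCombination_repr ⟨_, hm⟩)
    rw [Finsupp.linearCombination_apply, Finsupp.sum, AddSubmonoidClass.coe_finsetSum] at hrepr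
    change _ = e v • m at hrepr
    rw [← hrepr]
    refine Submodule.sum_mem _ fun i _ => ?_
    refine ⟨Finsupp.single i (algebraMap k R (b.repr ⟨_, hm⟩ i) •
      ⟨e v, Submodule.mem_span_singleton_self _⟩), ?_⟩
    have hb : e v • (b i : M) = b i := (b i).2
    simp only [Finsupp.lsum_single, ψ, LinearMap.comp_apply, LinearMap.toSpanSingleton_apply,
      Submodule.subtype_apply, Submodule.coe_smul, smul_eq_mul, mul_smul, hb]
    rfl

/-- Induction on an upper set `s` of vertices supporting `M`. For its least element `v`, the
approximation by copies of $R e_v$ is bijective on $e_v$-components. Both $M$ and $R e_v$ vanish at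
all $w < v$, so kernel and cokernel are supported on the rest of `s`. -/
theorem exists_hasProjectiveDimensionLT {R : Type u} [Ring R] [Algebra k R] {e : V → R}
    (h : IsTriangularFamily k e) (M : Type u) [AddCommGroup M] [Module R M] :
    ∃ d, HasProjectiveDimensionLT (ModuleCat.of R M) d := by
  suffices H : ∀ s : Finset V, IsUpperSet (s : Set V) → ∀ (M : Type u) [AddCommGroup M]
      [Module R M], (∀ w ∉ s, ∀ m : M, e w • m = 0) →
        ∃ d, HasProjectiveDimensionLT (ModuleCat.of R M) d from
    H Finset.univ (by simpa using isUpperSet_univ) M (by simp)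
  intro s
  induction s using Finset.induction_on_min with
  | empty =>
    intro _ M _ _ hM
    have : Subsingleton M := subsingleton_of_forall_eq 0 fun m => by
      rw [← one_smul R m, ← h.sum_eq_one, Finset.sum_smul]
      exact Finset.sum_eq_zero fun v _ => hM v (by simp) m
    exact ⟨0, (ModuleCat.isZero_of_subsingleton _).hasProjectiveDimensionLT_zero⟩
  | insert v s hv ih =>
    intro hs M _ _ hM
    -- In a linear order, whatever lies outside an upper set containing `v` lies below `v`.
    have hlt : ∀ w ∉ insert v s, w < v := fun w hw => by
      by_contra! hvw
      exact hw (by simpa using hs hvw (by simp))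
    have hs' : IsUpperSet (s : Set V) := by
      intro a b hab ha
      have hb : b ∈ insert v s := by simpa using hs hab (by simp [Finset.mem_coe.1 ha])
      rcases Finset.mem_insert.1 hb with rfl | hb
      · exact absurd (hv a ha) hab.not_gt
      · exact hb
    obtain ⟨ι, φ, hφ, hφ'⟩ := h.exists_approx v M
    have := h.projective_span v
    have : Module.Projective R (ι →₀ Submodule.span R {e v}) := by
      classical exact .of_equiv (finsuppLequivDFinsupp R).symm
    refine ModuleCat.exists_hasProjectiveDimensionLT_of_ker_of_coker φ
      (ih hs' _ fun w hw x => ?_) (ih hs' _ fun w hw x => ?_)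
    · apply Subtype.ext
      by_cases hwv : w = v
      · subst hwv
        exact hφ _ x.2
      · ext i
        obtain ⟨r, hr⟩ := Submodule.mem_span_singleton.1 (x.1 i).2
        change e w * (x.1 i : R) = 0
        rw [← hr, smul_eq_mul, ← mul_assoc]
        exact h.mul_mul_eq_zero (hlt w (by simp [hwv, hw])) r
    · obtain ⟨m, rfl⟩ := Submodule.mkQ_surjective _ x
      rw [← map_smul, Submodule.mkQ_apply, Submodule.Quotient.mk_eq_zero]
      by_cases hwv : w = v
      · subst hwv
        exact hφ' m
      · rw [hM w (by simp [hwv, hw])]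
        exact zero_mem _

end IsTriangularFamily

/-! ### Passage to the enveloping algebra -/

open MulOpposite in
theorem IsTriangularFamily.tmul_op {k A V : Type*} [Field k] [Ring A] [Algebra k A] [LinearOrder V]
    [Fintype V] {e : V → A} (h : IsTriangularFamily k e) :
    IsTriangularFamily k (R := A ⊗[k] Aᵐᵒᵖ) (V := V ×ₗ Vᵒᵈ)
      fun p => e (ofLex p).1 ⊗ₜ op (e (OrderDual.ofDual (ofLex p).2)) where
  idem p := by simp [← op_mul, h.idem]
  sum_eq_one := by
    rw [Algebra.TensorProduct.one_def, ← op_one, ← h.sum_eq_one, Finset.op_sum,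
      TensorProduct.sum_tmul]
    simp_rw [TensorProduct.tmul_sum]
    rw [← Fintype.sum_prod_type']
    rfl
  mul_mul_eq_zero := by
    intro w v hwv r
    induction r with
    | zero => simp
    | add x y hx hy => rw [mul_add, add_mul, hx, hy, add_zero]
    | tmul a b =>
      induction b using MulOpposite.rec' with | h b =>
      simp only [Algebra.TensorProduct.tmul_mul_tmul, ← op_mul]
      -- A strict inequality in the first coordinate kills the left factor. If the first coordinates
      -- agree, the right factor vanishes: `op` reverses products, which the dual order on the
      -- second coordinate compensates.
      rcases Prod.Lex.lt_iff.1 hwv with hlt | ⟨-, hlt⟩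
      · simp [h.mul_mul_eq_zero hlt]
      · rw [← mul_assoc, h.mul_mul_eq_zero (OrderDual.ofDual_lt_ofDual.2 hlt)]
        simp
  exists_smul_eq := by
    intro v r
    induction r with
    | zero => exact ⟨0, by simp⟩
    | add x y hx hy =>
      obtain ⟨c, hc⟩ := hx
      obtain ⟨d, hd⟩ := hy
      exact ⟨c + d, by rw [mul_add, add_mul, hc, hd, add_smul]⟩
    | tmul a b =>
      induction b using MulOpposite.rec' with | h b =>
      obtain ⟨c, hc⟩ := h.exists_smul_eq (ofLex v).1 a
      obtain ⟨d, hd⟩ := h.exists_smul_eq (OrderDual.ofDual (ofLex v).2) b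
      refine ⟨c * d, ?_⟩
      simp only [Algebra.TensorProduct.tmul_mul_tmul, ← op_mul]
      rw [← mul_assoc, hc, hd, op_smul, TensorProduct.smul_tmul_smul]

theorem finite_diagonalBimodule (k A : Type u) [CommRing k] [Ring A] [Algebra k A] :
    Module.Finite (A ⊗[k] Aᵐᵒᵖ) (diagonalBimodule k A) := by
  let o : diagonalBimodule k A := (1 : A)
  refine ⟨⟨{o}, ?_⟩⟩
  rw [eq_top_iff, Finset.coe_singleton]
  intro a _
  refine Submodule.mem_span_singleton.2 ⟨(show A from a) ⊗ₜ 1, ?_⟩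
  change (show A from a) • (1 : Aᵐᵒᵖ) • (1 : A) = a
  rw [one_smul]
  exact mul_one (show A from a)

theorem IsTriangularFamily.homologicallySmooth {k A : Type u} {V : Type*} [Field k] [Ring A]
    [Algebra k A] [Module.Finite k A] [LinearOrder V] [Fintype V] {e : V → A}
    (h : IsTriangularFamily k e) : HomologicallySmooth k A := by
  have : Module.Finite k Aᵐᵒᵖ := .equiv (MulOpposite.opLinearEquiv k)
  have : IsNoetherianRing (A ⊗[k] Aᵐᵒᵖ) := isNoetherian_of_tower k inferInstance
  have := finite_diagonalBimodule k A
  obtain ⟨d, hd⟩ := h.tmul_op.exists_hasProjectiveDimensionLT (diagonalBimodule k A)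
  exact HasFiniteCellResolution.of_hasProjectiveDimensionLE d (diagonalBimodule k A)
    (hasProjectiveDimensionLT_of_ge _ d (d + 1) (by lia))

/-! ### Paths in the doubled linear quiver -/

namespace LinVertex

variable {n : ℕ}

/-- Each arrow raises the number by one. This excludes nontrivial closed paths and paths to smaller
vertices, and it fixes the length by the endpoints, so there are only finitely many paths. -/
theorem val_add_length {a b : LinVertex n} (p : Quiver.Path a b) :
    Fin.val a + p.length = Fin.val b := by
  induction p with
  | nil => simp
  | cons p e ih => rw [Quiver.Path.length_cons, ← add_assoc, ih, e.step]

theorem path_eq_nil {a : LinVertex n} (p : Quiver.Path a a) : p = Quiver.Path.nil :=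
  Quiver.Path.eq_nil_of_length_zero p (by simpa using val_add_length p)

instance : Finite ArrowKind :=
  .of_surjective (fun b : Bool => if b then ArrowKind.x else ArrowKind.iota) fun
    | .x => ⟨true, rfl⟩
    | .iota => ⟨false, rfl⟩

instance (a b : LinVertex n) : Finite (a ⟶ b) :=
  .of_injective (fun e : LinArrow a b => e.kind) fun ⟨_, _⟩ ⟨_, _⟩ h => by
    cases h
    rfl

theorem finite_path (m : ℕ) (a b : LinVertex n) : Finite {p : Quiver.Path a b // p.length = m} := by
  induction m generalizing b with
  | zero =>
    refine @Finite.of_subsingleton _ ⟨?_⟩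
    rintro ⟨p, hp⟩ ⟨q, hq⟩
    obtain rfl := Quiver.Path.eq_of_length_zero p hp
    simp [path_eq_nil p, path_eq_nil q]
  | succ m ih =>
    refine .of_surjective (α := Σ c : LinVertex n, {p : Quiver.Path a c // p.length = m} × (c ⟶ b))
      (fun x => ⟨x.2.1.1.cons x.2.2, by simp [x.2.1.2]⟩) ?_
    rintro ⟨p, hp⟩
    cases p with
    | nil => simp at hp
    | cons p e => exact ⟨⟨_, ⟨p, by simpa using hp⟩, e⟩, rfl⟩

instance (a b : LinVertex n) : Finite (Quiver.Path a b) := by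
  have := finite_path (Fin.val b - Fin.val a) a b
  exact .of_injective (β := {p : Quiver.Path a b // p.length = Fin.val b - Fin.val a})
    (fun p => ⟨p, by have := val_add_length p; lia⟩) fun _ _ h => congrArg Subtype.val h

/-- The vertex with a given number. -/
def ofFin (i : Fin (n + 1)) : LinVertex n := i

end LinVertex

/-! ### Triangularity of the path algebra -/

namespace PathAlgebra

variable (k : Type*) [CommRing k]

instance {V : Type*} [Quiver V] [Finite (QPath V)] : Module.Finite k (PathAlgebra k V) :=
  inferInstanceAs (Module.Finite k (QPath V →₀ k))

variable {V : Type*} [Quiver V] [DecidableEq V] [Fintype V]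

theorem vertex_mul_vertex (v : V) : vertex k v * vertex k v = vertex k v := by
  simp [vertex, of_mul_of, mulPath]

theorem vertex_mul_of_mul_vertex_of_ne {w v : V} (p : QPath V) (h : p.1 ≠ v ∨ p.2.1 ≠ w) :
    vertex k w * of k p * vertex k v = 0 := by
  rcases h with h | h
  · rw [mul_assoc, vertex, vertex, of_mul_of, mulPath, dif_neg (Ne.symm h), mul_zero]
  · rw [vertex, vertex, of_mul_of, mulPath, dif_neg h, zero_mul]

variable {n : ℕ}

theorem vertex_mul_mul_vertex_eq_zero {w v : LinVertex n} (h : Fin.val w < Fin.val v)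
    (f : PathAlgebra k (LinVertex n)) : vertex k w * f * vertex k v = 0 := by
  induction f using induction_on with
  | zero => simp
  | add f g hf hg => rw [mul_add, add_mul, hf, hg, add_zero]
  | smul_of c p =>
    rw [mul_smul_comm, smul_mul_assoc, vertex_mul_of_mul_vertex_of_ne, smul_zero]
    by_contra! hp
    obtain ⟨rfl, rfl⟩ := hp
    have := LinVertex.val_add_length p.2.2
    lia

theorem exists_vertex_mul_mul_vertex_eq_smul (v : LinVertex n)
    (f : PathAlgebra k (LinVertex n)) : ∃ c : k, vertex k v * f * vertex k v = c • vertex k v := by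
  induction f using induction_on with
  | zero => exact ⟨0, by simp⟩
  | add f g hf hg =>
    obtain ⟨c, hc⟩ := hf
    obtain ⟨d, hd⟩ := hg
    exact ⟨c + d, by rw [mul_add, add_mul, hc, hd, add_smul]⟩
  | smul_of c p =>
    by_cases h : p.1 ≠ v ∨ p.2.1 ≠ v
    · exact ⟨0, by rw [mul_smul_comm, smul_mul_assoc, vertex_mul_of_mul_vertex_of_ne k p h]; simp⟩
    · obtain ⟨a, b, p⟩ := p
      push Not at h
      obtain ⟨ha, hb⟩ := h
      dsimp only at ha hb
      subst ha hb
      refine ⟨c, ?_⟩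
      have : of k ⟨b, b, p⟩ = vertex k b := by rw [LinVertex.path_eq_nil p]; rfl
      rw [this, mul_smul_comm, smul_mul_assoc, vertex_mul_vertex, vertex_mul_vertex]

end PathAlgebra

/-! ### Descent to the quotient $A_n$ -/

namespace AlgA

variable (k : Type*) [Field k] (n : ℕ)

instance : Module.Finite k (AlgA k n) :=
  .of_surjective (RingQuot.mkAlgHom k (ARel k n)).toLinearMap (RingQuot.mkAlgHom_surjective k _)

theorem isTriangularFamily : IsTriangularFamily k (V := Fin (n + 1))
    fun i => RingQuot.mkAlgHom k (ARel k n) (PathAlgebra.vertex k (LinVertex.ofFin i)) where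
  idem i := by rw [← map_mul, PathAlgebra.vertex_mul_vertex]
  sum_eq_one := by
    rw [← map_sum]
    exact map_one (RingQuot.mkAlgHom k (ARel k n))
  mul_mul_eq_zero := by
    intro w v h r
    obtain ⟨r, rfl⟩ := RingQuot.mkAlgHom_surjective k (ARel k n) r
    rw [← map_mul, ← map_mul, PathAlgebra.vertex_mul_mul_vertex_eq_zero k (w := LinVertex.ofFin w)
      (v := LinVertex.ofFin v) h, map_zero]
  exists_smul_eq := by
    intro v r
    obtain ⟨r, rfl⟩ := RingQuot.mkAlgHom_surjective k (ARel k n) r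
    obtain ⟨c, hc⟩ := PathAlgebra.exists_vertex_mul_mul_vertex_eq_smul k (LinVertex.ofFin v) r
    exact ⟨c, by rw [← map_mul, ← map_mul, hc, map_smul]⟩

end AlgA

theorem proposition3p2 (n : ℕ) : HomologicallySmooth (ZMod 2) (AlgA (ZMod 2) n) :=
  (AlgA.isTriangularFamily (ZMod 2) n).homologicallySmooth
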